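/- Let $S_1\colon H_1\to G_1$ be a compact linear operator between real Hilbert spaces, $H_1$ infinite-dimensional, and let $(e_m,\lambda_m)_{m\ge 1}$ be the eigenpairs of $W_1=S_1^\dagger S_1$ with respect to a non-increasing ordering: $(e_m)$ is orthonormal, $W_1e_m=\lambda_me_m$, $\lambda_1\ge\lambda_2\ge\dots\ge 0$, and $W_1$ vanishes on the orthogonal complement of $\{e_m: m\ge 1\}$ (for instance, $(e_m)$ is an orthonormal basis of $H_1$). For $d\ge1$ let $S_d=S_1\otimes\dots\otimes S_1\colon H_d\to G_d$ be the $d$-fold tensor product operator between the Hilbert space tensor powers $H_d=H_1^{\otimes d}$ and $G_d=G_1^{\otimes d}$, and let $\mathfrak A(H_d)\subseteq H_d$ be the subspace of fully antisymmetric elements, i.e. of those $f$ with $f=(-1)^{|\pi|}\,\pi\cdot f$ for all permutations $\pi$ of $\{1,\dots,d\}$, where $\pi$ acts by permuting the $d$ tensor factors. For an operator $T\colon X\to Y$, where either $T=S_d|_{\mathfrak A(H_d)}$ or $T=S_1$, let $e(n;T)=\inf_A\sup_{\|f\|\le1}\|A f-T f\|$, where $A$ runs through the algorithms that use $n$ continuous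 linear functionals on $X$: either all linear ones, $Af=\sum_{v=1}^nL_v(f)\,g_v$ with $L_v\in X^*$ and $g_v\in Y$, or all adaptive ones, $Af=\varphi(y_1,\dots,y_n)$ with $y_v=L_v(f;y_1,\dots,y_{v-1})$, $L_v(\,\cdot\,;y_1,\dots,y_{v-1})\in X^*$ and $\varphi$ arbitrary (the statement holds for each of these two classes, the same one being used for both problems). For $\epsilon>0$ let $$n(\epsilon;T)=\min\{n\in\mathbb N_0 : e(n;T)\le\epsilon\},\qquad n^{\rm asy}(\epsilon,d)=n(\epsilon;S_d|_{\mathfrak A(H_d)}),\qquad n^{\rm ent}(\epsilon,1)=n(\epsilon;S_1),$$ and for $t>0$ and $j\in\mathbb N$ let $$i_j(t)=\min\{i\in\mathbb N : \lambda_i\lambda_{i+1}\cdots\lambda_{i+j-1}\le t\}.$$ Then all these minima exist, and for every $\epsilon>0$ we have $n^{\rm asy}(\epsilon,1)=n^{\rm ent}(\epsilon,1)$ and, for every $d\ge2$, $$n^{\rm asy}(\epsilon,d)=\sum_{l_1=2}^{i_d(\epsilon^2)}\ \sum_{l_2=l_1+1}^{i_{d-1}(\epsilon^2/\lambda_{l_1-1})}\cdots\sum_{l_{d-1}=l_{d-2}+1}^{i_2(\epsilon^2/[\lambda_{l_1-1}\cdots\lambda_{l_{d-2}-1}])}\left[n^{\rm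 ent}\!\left(\frac{\epsilon}{\sqrt{\lambda_{l_1-1}\cdots\lambda_{l_{d-1}-1}}},1\right)-l_{d-1}+1\right],$$ where empty sums are zero. -/

import Mathlib

open scoped TensorProduct ENNReal Matrix

noncomputable section

namespace AntisymComplexity

universe u v

section TensorPower

variable (H : Type u) [NormedAddCommGroup H] [InnerProductSpace ℝ H] (d : ℕ)

/-- The algebraic `d`-fold tensor power of a real inner product space. It is a type of its own so
that it carries the inner product below (and not the projective seminorm). -/
def PreTensorPower : Type u := ⨂[ℝ] _ : Fin d, H

instance : AddCommGroup (PreTensorPower H d) :=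
  inferInstanceAs (AddCommGroup (⨂[ℝ] _ : Fin d, H))

instance : Module ℝ (PreTensorPower H d) :=
  inferInstanceAs (Module ℝ (⨂[ℝ] _ : Fin d, H))

variable {H d}

/-- The simple tensor `f 0 ⊗ ⋯ ⊗ f (d - 1)` in the algebraic tensor power. -/
def preTprod (f : Fin d → H) : PreTensorPower H d := PiTensorProduct.tprod ℝ f

theorem exists_eq_sum (x : PreTensorPower H d) :
    ∃ (n : ℕ) (c : Fin n → ℝ) (f : Fin n → Fin d → H), x = ∑ i, c i • preTprod (f i) := by
  have hx : x ∈ Submodule.span ℝ (Set.range (preTprod : (Fin d → H) → PreTensorPower H d)) := by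
    have h : Submodule.span ℝ (Set.range (preTprod : (Fin d → H) → PreTensorPower H d)) = ⊤ :=
      PiTensorProduct.span_tprod_eq_top (R := ℝ) (s := fun _ : Fin d => H)
    rw [h]
    trivial
  obtain ⟨n, c, g, hg⟩ := Submodule.mem_span_set'.1 hx
  choose f hf using fun i => (g i).2
  refine ⟨n, c, f, ?_⟩
  rw [← hg]
  exact Finset.sum_congr rfl fun i _ => congrArg (fun t => c i • t) (hf i).symm

variable (H d)

/-- The bilinear form with `⟨⨂ f_l, ⨂ g_l⟩ = ∏ ⟨f_l, g_l⟩`. -/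
def preInner : PreTensorPower H d →ₗ[ℝ] PreTensorPower H d →ₗ[ℝ] ℝ :=
  (PiTensorProduct.dualDistrib (R := ℝ) (M := fun _ : Fin d => H)) ∘ₗ
    (PiTensorProduct.map fun _ : Fin d => innerₗ H)

variable {H d}

theorem preInner_tprod (f g : Fin d → H) :
    preInner H d (preTprod f) (preTprod g) = ∏ l, inner ℝ (f l) (g l) := by
  have h : (PiTensorProduct.map fun _ : Fin d => innerₗ H) (PiTensorProduct.tprod ℝ f) =
      PiTensorProduct.tprod ℝ fun l => innerₗ H (f l) := PiTensorProduct.map_tprod _ _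
  exact (congrArg (fun t => PiTensorProduct.dualDistrib t (PiTensorProduct.tprod ℝ g)) h).trans
    (PiTensorProduct.dualDistrib_apply _ _)

theorem preInner_sum {n : ℕ} (c : Fin n → ℝ) (f : Fin n → Fin d → H) :
    preInner H d (∑ i, c i • preTprod (f i)) (∑ i, c i • preTprod (f i)) =
      c ⬝ᵥ (Matrix.of fun i j => ∏ l, inner ℝ (f i l) (f j l)) *ᵥ c := by
  simp only [map_sum, map_smul, LinearMap.sum_apply, LinearMap.smul_apply, preInner_tprod,
    smul_eq_mul, dotProduct, Matrix.mulVec, Matrix.of_apply, Finset.mul_sum]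
  rw [Finset.sum_comm]
  exact Finset.sum_congr rfl fun i _ => Finset.sum_congr rfl fun j _ => by ring

theorem preInner_comm (x y : PreTensorPower H d) : preInner H d x y = preInner H d y x := by
  obtain ⟨n, c, f, rfl⟩ := exists_eq_sum x
  obtain ⟨m, b, g, rfl⟩ := exists_eq_sum y
  simp only [map_sum, map_smul, LinearMap.sum_apply, LinearMap.smul_apply, preInner_tprod,
    smul_eq_mul]
  simp only [Finset.mul_sum]
  rw [Finset.sum_comm]
  refine Finset.sum_congr rfl fun i _ => Finset.sum_congr rfl fun j _ => ?_
  simp only [real_inner_comm]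
  ring

/-- A Schur product inequality for finite families of positive semidefinite matrices. -/
theorem posSemidef_prod {ι κ : Type*} [Finite ι] (s : Finset κ) (A B : κ → Matrix ι ι ℝ)
    (hA : ∀ l, (A l).PosSemidef) (hAB : ∀ l, (B l - A l).PosSemidef) :
    (Matrix.of fun i j => ∏ l ∈ s, A l i j).PosSemidef ∧
      ((Matrix.of fun i j => ∏ l ∈ s, B l i j) -
        (Matrix.of fun i j => ∏ l ∈ s, A l i j)).PosSemidef := by
  classical
  have := Fintype.ofFinite ι
  induction s using Finset.induction_on with
  | empty =>
    refine ⟨?_, by simpa using Matrix.PosSemidef.zero⟩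
    have h : (Matrix.of fun i j => ∏ l ∈ (∅ : Finset κ), A l i j) =
        Matrix.gram ℝ fun _ : ι => (1 : ℝ) := by
      ext i j
      simp
    rw [h]
    exact Matrix.posSemidef_gram ℝ _
  | insert a s ha ih =>
    obtain ⟨h1, h2⟩ := ih
    have hB : (B a).PosSemidef := by
      have := (hAB a).add (hA a)
      simpa using this
    refine ⟨?_, ?_⟩
    · have h : (Matrix.of fun i j => ∏ l ∈ insert a s, A l i j) =
          A a ⊙ (Matrix.of fun i j => ∏ l ∈ s, A l i j) := by
        ext i j
        simp [Finset.prod_insert ha]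
      rw [h]
      exact (hA a).hadamard h1
    · have h : (Matrix.of fun i j => ∏ l ∈ insert a s, B l i j) -
          (Matrix.of fun i j => ∏ l ∈ insert a s, A l i j) =
          B a ⊙ ((Matrix.of fun i j => ∏ l ∈ s, B l i j) -
            (Matrix.of fun i j => ∏ l ∈ s, A l i j)) +
          (B a - A a) ⊙ (Matrix.of fun i j => ∏ l ∈ s, A l i j) := by
        ext i j
        simp [Finset.prod_insert ha]
        ring
      rw [h]
      exact (hB.hadamard h2).add ((hAB a).hadamard h1)

theorem preInner_self_nonneg (x : PreTensorPower H d) : 0 ≤ preInner H d x x := by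
  obtain ⟨n, c, f, rfl⟩ := exists_eq_sum x
  rw [preInner_sum]
  have h := (posSemidef_prod Finset.univ (fun l => Matrix.gram ℝ fun i => f i l)
    (fun l => Matrix.gram ℝ fun i => f i l) (fun l => Matrix.posSemidef_gram ℝ _)
    (fun l => by simpa using Matrix.PosSemidef.zero)).1
  simpa using h.dotProduct_mulVec_nonneg c

variable (H d)

/-- The (pre-)inner product of the algebraic tensor power. -/
@[reducible] def preCore : PreInnerProductSpace.Core ℝ (PreTensorPower H d) where
  inner x y := preInner H d x y
  conj_inner_symm x y := preInner_comm y x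
  re_inner_nonneg x := preInner_self_nonneg x
  add_left x y z := by simp
  smul_left x y r := by simp

instance : SeminormedAddCommGroup (PreTensorPower H d) :=
  @InnerProductSpace.Core.toSeminormedAddCommGroup ℝ _ _ _ _ (preCore H d)

instance : InnerProductSpace ℝ (PreTensorPower H d) :=
  InnerProductSpace.ofCore (preCore H d)

/-- The Hilbert space tensor power `H ⊗ ⋯ ⊗ H` (`d` times): the completion of the algebraic tensor
power with respect to `⟨⨂ f_l, ⨂ g_l⟩ = ∏ ⟨f_l, g_l⟩`. -/
abbrev TensorPower : Type u := UniformSpace.Completion (PreTensorPower H d)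

variable {H d}

/-- The simple tensor `f 0 ⊗ ⋯ ⊗ f (d - 1)`. -/
def tprod (f : Fin d → H) : TensorPower H d := (preTprod f : PreTensorPower H d)

theorem inner_pre (x y : PreTensorPower H d) : inner ℝ x y = preInner H d x y := rfl

theorem inner_tprod (f g : Fin d → H) :
    inner ℝ (tprod f) (tprod g) = ∏ l, inner ℝ (f l) (g l) := by
  simp only [tprod, UniformSpace.Completion.inner_coe, inner_pre, preInner_tprod]

theorem norm_sq_pre (x : PreTensorPower H d) : ‖x‖ ^ 2 = preInner H d x x := by
  rw [← real_inner_self_eq_norm_sq, inner_pre]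

section Map

variable {G : Type v} [NormedAddCommGroup G] [InnerProductSpace ℝ G]

variable (d) in
/-- The algebraic tensor power of an operator. -/
def preMapₗ (S : H →L[ℝ] G) : PreTensorPower H d →ₗ[ℝ] PreTensorPower G d :=
  PiTensorProduct.map fun _ : Fin d => S.toLinearMap

theorem preMapₗ_tprod (S : H →L[ℝ] G) (f : Fin d → H) :
    preMapₗ d S (preTprod f) = preTprod fun l => S (f l) :=
  PiTensorProduct.map_tprod _ _

theorem gram_le (S : H →L[ℝ] G) {n : ℕ} (f : Fin n → H) :
    ((‖S‖ ^ 2) • Matrix.gram ℝ f - Matrix.gram ℝ fun i => S (f i)).PosSemidef := by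
  refine .of_dotProduct_mulVec_nonneg ?_ fun x => ?_
  · refine Matrix.IsHermitian.sub ?_ (Matrix.isHermitian_gram ℝ _)
    ext i j
    simp [Matrix.gram, real_inner_comm]
  · rw [Matrix.sub_mulVec, dotProduct_sub, Matrix.smul_mulVec, dotProduct_smul,
      Matrix.star_dotProduct_gram_mulVec, Matrix.star_dotProduct_gram_mulVec]
    have h : ∑ i, x i • S (f i) = S (∑ i, x i • f i) := by simp
    rw [h, real_inner_self_eq_norm_sq, real_inner_self_eq_norm_sq, smul_eq_mul, ← mul_pow,
      sub_nonneg]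
    exact pow_le_pow_left₀ (norm_nonneg _) (S.le_opNorm _) 2

theorem norm_preMapₗ_le (S : H →L[ℝ] G) (x : PreTensorPower H d) :
    ‖preMapₗ d S x‖ ≤ ‖S‖ ^ d * ‖x‖ := by
  refine le_of_sq_le_sq ?_ (by positivity)
  rw [mul_pow, norm_sq_pre, norm_sq_pre]
  obtain ⟨n, c, f, rfl⟩ := exists_eq_sum x
  have h := (posSemidef_prod Finset.univ (fun l => Matrix.gram ℝ fun i => S (f i l))
    (fun l => (‖S‖ ^ 2) • Matrix.gram ℝ fun i => f i l) (fun l => Matrix.posSemidef_gram ℝ _)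
    (fun l => gram_le S _)).2.dotProduct_mulVec_nonneg c
  simp only [map_sum, map_smul, preMapₗ_tprod]
  have h1 := preInner_sum c f
  have h2 := preInner_sum c fun i l => S (f i l)
  simp only [map_sum, map_smul] at h1 h2
  rw [h1, h2]
  rw [Matrix.sub_mulVec, dotProduct_sub, sub_nonneg] at h
  refine h.trans_eq ?_
  have e : (Matrix.of fun i j => ∏ l, ((‖S‖ ^ 2) • Matrix.gram ℝ fun i => f i l) i j) =
      ((‖S‖ ^ d) ^ 2) • Matrix.of fun i j => ∏ l, inner ℝ (f i l) (f j l) := by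
    ext i j
    simp [Matrix.gram, Finset.prod_mul_distrib, ← pow_mul, mul_comm]
  rw [e, Matrix.smul_mulVec, dotProduct_smul, smul_eq_mul]
  rfl

variable (d) in
/-- The tensor power operator `S_d = S ⊗ ⋯ ⊗ S` (`d` times), the continuous linear extension of
`f 0 ⊗ ⋯ ⊗ f (d - 1) ↦ S (f 0) ⊗ ⋯ ⊗ S (f (d - 1))`. -/
def tensorPowerMap (S : H →L[ℝ] G) : TensorPower H d →L[ℝ] TensorPower G d :=
  ((preMapₗ d S).mkContinuous (‖S‖ ^ d) (norm_preMapₗ_le S)).completion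

theorem tensorPowerMap_tprod (S : H →L[ℝ] G) (f : Fin d → H) :
    tensorPowerMap d S (tprod f) = tprod fun l => S (f l) := by
  simp [tensorPowerMap, tprod, preMapₗ_tprod]

end Map

section Permutations

/-- The action of a permutation on the algebraic tensor power. -/
def prePermuteₗ (π : Equiv.Perm (Fin d)) : PreTensorPower H d →ₗ[ℝ] PreTensorPower H d :=
  (PiTensorProduct.reindex ℝ (fun _ : Fin d => H) π).toLinearMap

theorem prePermuteₗ_tprod (π : Equiv.Perm (Fin d)) (f : Fin d → H) :
    prePermuteₗ π (preTprod f) = preTprod fun l => f (π⁻¹ l) :=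
  PiTensorProduct.reindex_tprod π f

theorem norm_prePermuteₗ (π : Equiv.Perm (Fin d)) (x : PreTensorPower H d) :
    ‖prePermuteₗ π x‖ ≤ 1 * ‖x‖ := by
  refine le_of_sq_le_sq ?_ (by positivity)
  rw [one_mul, norm_sq_pre, norm_sq_pre]
  obtain ⟨n, c, f, rfl⟩ := exists_eq_sum x
  simp only [map_sum, map_smul, LinearMap.sum_apply, LinearMap.smul_apply, prePermuteₗ_tprod,
    preInner_tprod]
  refine (Finset.sum_congr rfl fun i _ => ?_).le
  congr 1
  refine Finset.sum_congr rfl fun j _ => ?_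
  congr 1
  exact Equiv.prod_comp π⁻¹ fun l => inner ℝ (f j l) (f i l)

/-- The action of a permutation `π` on the tensor power. For spaces of functions, in which
`⨂ f_l` is `x ↦ ∏ f_l (x_l)`, this is `f ↦ f (x_{π 1}, …, x_{π d})`, as
`∏ f_l (x_{π l}) = ∏ f_{π⁻¹ l} (x_l)`. -/
def permute (π : Equiv.Perm (Fin d)) : TensorPower H d →L[ℝ] TensorPower H d :=
  ((prePermuteₗ π).mkContinuous 1 (norm_prePermuteₗ π)).completion

theorem permute_tprod (π : Equiv.Perm (Fin d)) (f : Fin d → H) :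
    permute π (tprod f) = tprod fun l => f (π⁻¹ l) := by
  simp [permute, tprod, prePermuteₗ_tprod]

theorem permute_mul (π σ : Equiv.Perm (Fin d)) (x : TensorPower H d) :
    permute (π * σ) x = permute π (permute σ x) := by
  induction x using UniformSpace.Completion.induction_on with
  | hp => exact isClosed_eq (by fun_prop) (by fun_prop)
  | ih x =>
    obtain ⟨n, c, f, rfl⟩ := exists_eq_sum x
    simp only [permute, ContinuousLinearMap.completion_apply_coe, LinearMap.mkContinuous_apply,
      map_sum, map_smul, prePermuteₗ_tprod, mul_inv_rev, Equiv.Perm.mul_apply]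

variable (H d)

/-- The fully antisymmetric elements: `f = (-1)^{|π|} f ∘ π` for all permutations `π`. -/
def antisymSubspace : Submodule ℝ (TensorPower H d) where
  carrier := {f | ∀ π : Equiv.Perm (Fin d), f = ((Equiv.Perm.sign π : ℤ) : ℝ) • permute π f}
  add_mem' {f g} hf hg π := by rw [map_add, smul_add, ← hf π, ← hg π]
  zero_mem' π := by simp
  smul_mem' c f hf π := by rw [map_smul, smul_comm, ← hf π]

/-- The antisymmetrizer `f ↦ (1 / d!) ∑_π (-1)^{|π|} f ∘ π`. -/
def antisymmetrizer : TensorPower H d →L[ℝ] TensorPower H d :=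
  ((d.factorial : ℝ)⁻¹) • ∑ π : Equiv.Perm (Fin d), ((Equiv.Perm.sign π : ℤ) : ℝ) • permute π

/-- The antisymmetric elements are exactly the range of the antisymmetrizer. -/
theorem range_antisymmetrizer :
    Set.range (antisymmetrizer H d) = (antisymSubspace H d : Set (TensorPower H d)) := by
  have hs : ∀ π : Equiv.Perm (Fin d),
      ((Equiv.Perm.sign π : ℤ) : ℝ) * ((Equiv.Perm.sign π : ℤ) : ℝ) = 1 := fun π => by
    rw [← Int.cast_mul, ← Units.val_mul, Int.units_mul_self]; simp
  ext f
  constructor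
  · rintro ⟨g, rfl⟩ σ
    simp only [antisymmetrizer, smul_apply, sum_apply,
      map_smul, map_sum]
    rw [smul_comm]
    congr 1
    rw [Finset.smul_sum, ← Equiv.sum_comp (Equiv.mulLeft σ)]
    refine Finset.sum_congr rfl fun π _ => ?_
    simp only [Equiv.coe_mulLeft, permute_mul, smul_smul, map_mul, Units.val_mul, Int.cast_mul]
  · intro hf
    refine ⟨f, ?_⟩
    simp only [antisymmetrizer, smul_apply, sum_apply]
    rw [Finset.sum_congr rfl fun π _ => (hf π).symm, Finset.sum_const, Finset.card_univ,
      Fintype.card_perm, Fintype.card_fin, ← Nat.cast_smul_eq_nsmul ℝ, smul_smul,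
      inv_mul_cancel₀ (by positivity), one_smul]

end Permutations

end TensorPower

section Complexity

variable {X : Type u} {Y : Type v} [NormedAddCommGroup X] [NormedSpace ℝ X]
  [NormedAddCommGroup Y] [NormedSpace ℝ Y]

/-- Two classes of algorithms based on continuous linear functionals: `linear` is the class of
linear non-adaptive algorithms `f ↦ ∑ L_v f • g_v`; `adaptive` is the class of all algorithms
`φ ∘ N` with adaptively chosen continuous linear functionals and arbitrary `φ`. -/
inductive AlgorithmClass
  | linear
  | adaptive

/-- Adaptive information: `L y` is the functional that is evaluated after the values `y` have been
observed; the result is the list of the first `n` observed values `y_1, …, y_n`. -/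
def adaptiveInfo (L : List ℝ → (X →L[ℝ] ℝ)) : ℕ → X → List ℝ
  | 0, _ => []
  | n + 1, f => adaptiveInfo L n f ++ [L (adaptiveInfo L n f) f]

/-- The algorithms `X → Y` of a class that use `n` continuous linear functionals. -/
def algorithms : AlgorithmClass → ℕ → Set (X → Y)
  | .linear, n => {A | ∃ (L : Fin n → (X →L[ℝ] ℝ)) (g : Fin n → Y), ∀ f, A f = ∑ v, L v f • g v}
  | .adaptive, n => {A | ∃ (L : List ℝ → (X →L[ℝ] ℝ)) (φ : List ℝ → Y),
      ∀ f, A f = φ (adaptiveInfo L n f)}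

/-- The worst case error of `A` for the approximation of `T` on the unit ball. -/
def worstCaseError (T : X →L[ℝ] Y) (A : X → Y) : ℝ≥0∞ :=
  ⨆ f ∈ Metric.closedBall (0 : X) 1, ‖A f - T f‖ₑ

/-- The `n`-th minimal worst case error for the approximation of `T`. -/
def minimalError (c : AlgorithmClass) (T : X →L[ℝ] Y) (n : ℕ) : ℝ≥0∞ :=
  ⨅ A ∈ algorithms c n, worstCaseError T A

/-- The numbers of functionals with which a worst case error of at most `ε` is possible. -/
def sufficientInfo (c : AlgorithmClass) (T : X →L[ℝ] Y) (ε : ℝ) : Set ℕ :=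
  {n | minimalError c T n ≤ ENNReal.ofReal ε}

/-- The information complexity: the smallest number of functionals with which a worst case error
of at most `ε` is possible. -/
def infoComplexity (c : AlgorithmClass) (T : X →L[ℝ] Y) (ε : ℝ) : ℕ :=
  sInf (sufficientInfo c T ε)

end Complexity

section Problem

variable {H : Type u} [NormedAddCommGroup H] [InnerProductSpace ℝ H]
variable {G : Type v} [NormedAddCommGroup G] [InnerProductSpace ℝ G]

/-- The fully antisymmetric problem: `S_d` restricted to the antisymmetric subspace. -/
def antisymProblem (S : H →L[ℝ] G) (d : ℕ) : antisymSubspace H d →L[ℝ] TensorPower G d :=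
  (tensorPowerMap d S).comp (antisymSubspace H d).subtypeL

/-- `(e 1, lam 1), (e 2, lam 2), …` (the values at `0` play no role) is the sequence of eigenpairs
of `W`, with respect to a non-increasing ordering of the eigenvalues: the `e i` are orthonormal
eigenvectors, and `W` vanishes on the orthogonal complement of all of them. -/
structure IsEigenpairSequence (W : H →L[ℝ] H) (e : ℕ → H) (lam : ℕ → ℝ) : Prop where
  orthonormal : Orthonormal ℝ fun i : ℕ => e (i + 1)
  apply_eq : ∀ i, 1 ≤ i → W (e i) = lam i • e i
  succ_le : ∀ i, 1 ≤ i → lam (i + 1) ≤ lam i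
  apply_eq_zero : ∀ f : H, (∀ i, 1 ≤ i → inner ℝ (e i) f = 0) → W f = 0

/-- The positive integers `i` with `lam i * lam (i + 1) * ⋯ * lam (i + j - 1) ≤ t`. -/
def indexSet (lam : ℕ → ℝ) (j : ℕ) (t : ℝ) : Set ℕ :=
  {i | 1 ≤ i ∧ ∏ m ∈ Finset.range j, lam (i + m) ≤ t}

/-- `i_j(t) = min {i ≥ 1 : lam i * lam (i + 1) * ⋯ * lam (i + j - 1) ≤ t}`. -/
def index (lam : ℕ → ℝ) (j : ℕ) (t : ℝ) : ℕ := sInf (indexSet lam j t)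

/-- The `k` innermost sums of the nested sum, as a function of the product `P` of the numbers
`lam (l - 1)` over the outer summation indices `l`, and of the last outer index `l'`. The outermost
one of these `k` sums runs over `l' + 1 ≤ l ≤ i_{k+1}(ε² / P)`. -/
def nestedSum (lam : ℕ → ℝ) (nEnt : ℝ → ℕ) (ε : ℝ) : (k : ℕ) → (P : ℝ) → (l' : ℕ) → ℤ
  | 0, P, l' => (nEnt (ε / √P) : ℤ) - l' + 1
  | k + 1, P, l' => ∑ l ∈ Finset.Icc (l' + 1) (index lam (k + 2) (ε ^ 2 / P)),
      nestedSum lam nEnt ε k (P * lam (l - 1)) l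

end Problem

end AntisymComplexity

end

/-! Both problems are diagonalised by an orthonormal family, and both complexities then count
singular values.

For an operator `T` with a singular system of squared singular values `μ i`, the least number of
functionals that reaches error `δ` is the number of `i` with `δ ^ 2 < μ i`
(`IsSingularSystem.isLeast_ncard`). Projecting onto those directions is a linear algorithm of error
at most `δ`. Conversely, with fewer functionals some unit vector `y` in their span is invisible
along the path on which every answer is zero. An adaptive algorithm cannot tell `y` from `-y`, so
its error is at least `‖T y‖`, which exceeds `δ`.

For `S` the singular system is `e`, with values `lam`. For the antisymmetric problem it consists of
the normalised antisymmetrised products of `e (k 0), …, e (k (d - 1))` with `k` strictly increasing,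
with values `∏ l, lam (k l)` (`isSingularSystem_antisymProblem`). So the complexity is the number of
strictly increasing `k` with `ε ^ 2 < ∏ l, lam (k l)`, and this set is finite because compactness
forces `lam` to tend to zero.

The nested sum counts these tuples by their successive entries (`tupleSet_succ`,
`nestedSum_eq_ncard`). A first entry `j` is possible exactly if the consecutive block starting at
`j`, which has the largest product, is still above the threshold; this is `j < index …`. The
summation index is `j + 1`. The last entry is counted by the univariate complexity, minus the
indices that are too small. -/

namespace AntisymComplexity

/-! ### Information complexity of an operator with a singular system -/

section InformationComplexity

variable {X : Type u} {Y : Type v} [NormedAddCommGroup X] [NormedAddCommGroup Y]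

theorem adaptiveInfo_length [NormedSpace ℝ X] (L : ℕ → (X →L[ℝ] ℝ)) (n : ℕ) (f : X) :
    adaptiveInfo (fun y => L y.length) n f = (List.range n).map fun v => L v f := by
  induction n with
  | zero => rfl
  | succ n ih => simp [adaptiveInfo, ih, List.range_succ]

theorem algorithms_linear_subset [NormedSpace ℝ X] [NormedSpace ℝ Y] (n : ℕ) :
    (algorithms .linear n : Set (X → Y)) ⊆ algorithms .adaptive n := by
  rintro A ⟨L, g, hA⟩
  -- The length of the observed list serves as the step counter. Neither default value `0` is ever
  -- used: the `n` steps see only lists shorter than `n`, and the final list has length `n`.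
  refine ⟨fun y => if h : y.length < n then L ⟨y.length, h⟩ else 0,
    fun y => ∑ v : Fin n, y.getD v 0 • g v, fun f => ?_⟩
  rw [adaptiveInfo_length (fun m => if h : m < n then L ⟨m, h⟩ else 0), hA]
  refine Finset.sum_congr rfl fun v _ => ?_
  simp [List.getD]

theorem adaptiveInfo_eq_replicate [NormedSpace ℝ X] (L : List ℝ → (X →L[ℝ] ℝ)) (n : ℕ) (f : X)
    (h : ∀ v < n, L (List.replicate v 0) f = 0) : adaptiveInfo L n f = List.replicate n 0 := by
  induction n with
  | zero => rfl
  | succ n ih =>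
    rw [adaptiveInfo, ih fun v hv => h v (hv.trans n.lt_succ_self), h n n.lt_succ_self,
      List.replicate_succ']

/-- The common output for `f` and `-f` lies at distance at least `‖T f‖` from one of `T f` and `-T
f`, as these are `2 * ‖T f‖` apart. -/
theorem enorm_le_worstCaseError [NormedSpace ℝ X] [NormedSpace ℝ Y] (T : X →L[ℝ] Y) (A : X → Y)
    {f : X} (hf : ‖f‖ ≤ 1) (hA : A f = A (-f)) : ‖T f‖ₑ ≤ worstCaseError T A := by
  have h1 : ‖A f - T f‖ₑ ≤ worstCaseError T A :=
    le_iSup₂_of_le f (by simpa using hf) le_rfl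
  have h2 : ‖A (-f) - T (-f)‖ₑ ≤ worstCaseError T A :=
    le_iSup₂_of_le (-f) (by simpa using hf) le_rfl
  have h3 : ‖T f‖ ≤ max ‖A f - T f‖ ‖A (-f) - T (-f)‖ := by
    have h : (2 : ℝ) • T f = (A (-f) - T (-f)) - (A f - T f) := by
      rw [hA, map_neg, two_smul]; abel
    have h' := congrArg norm h
    rw [norm_smul, Real.norm_ofNat] at h'
    have := norm_sub_le (A (-f) - T (-f)) (A f - T f)
    rcases le_total ‖A f - T f‖ ‖A (-f) - T (-f)‖ with hm | hm
    · rw [max_eq_right hm]; linarith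
    · rw [max_eq_left hm]; linarith
  rcases le_max_iff.1 h3 with h | h
  · exact (enorm_le_iff_norm_le.2 h).trans h1
  · exact (enorm_le_iff_norm_le.2 h).trans h2

variable [InnerProductSpace ℝ X] [InnerProductSpace ℝ Y] {ι : Type*}

/-- `f` is a singular system of `T` with squared singular values `μ`: an orthonormal family with
orthogonal images, such that `T` vanishes on the orthogonal complement. -/
structure IsSingularSystem (T : X →L[ℝ] Y) (f : ι → X) (μ : ι → ℝ) : Prop where
  orthonormal : Orthonormal ℝ f
  inner_map_self : ∀ i, inner ℝ (T (f i)) (T (f i)) = μ i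
  inner_map_ne : ∀ i j, i ≠ j → inner ℝ (T (f i)) (T (f j)) = 0
  map_eq_zero : ∀ x, (∀ i, inner ℝ (f i) x = 0) → T x = 0

namespace IsSingularSystem

variable {T : X →L[ℝ] Y} {f : ι → X} {μ : ι → ℝ}

theorem norm_sq_sum (h : IsSingularSystem T f μ) (s : Finset ι) (c : ι → ℝ) :
    ‖∑ i ∈ s, c i • f i‖ ^ 2 = ∑ i ∈ s, c i ^ 2 := by
  rw [← real_inner_self_eq_norm_sq, h.orthonormal.inner_sum]
  simp [sq]

theorem norm_sq_map_sum (h : IsSingularSystem T f μ) (s : Finset ι) (c : ι → ℝ) :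
    ‖T (∑ i ∈ s, c i • f i)‖ ^ 2 = ∑ i ∈ s, c i ^ 2 * μ i := by
  classical
  rw [← real_inner_self_eq_norm_sq]
  simp only [map_sum, map_smul, sum_inner, inner_sum, real_inner_smul_left, real_inner_smul_right]
  refine Finset.sum_congr rfl fun i hi => ?_
  rw [Finset.sum_eq_single i (fun j _ hj => by rw [h.inner_map_ne _ _ hj]; ring)
    (fun hi' => (hi' hi).elim), h.inner_map_self]
  ring

/-- Pythagoras in both spaces gives the bound for finite combinations, and the bound is a closed
condition. -/
theorem norm_map_le_of_mem_span (h : IsSingularSystem T f μ) {δ : ℝ} (hδ : 0 ≤ δ) {s : Set ι}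
    (hs : ∀ i ∈ s, μ i ≤ δ ^ 2) {x : X}
    (hx : x ∈ (Submodule.span ℝ (f '' s)).topologicalClosure) : ‖T x‖ ≤ δ * ‖x‖ := by
  have hcl : IsClosed {x : X | ‖T x‖ ≤ δ * ‖x‖} := isClosed_le (by fun_prop) (by fun_prop)
  refine closure_minimal (s := (Submodule.span ℝ (f '' s) : Set X)) (fun y hy => ?_) hcl hx
  obtain ⟨l, hl, rfl⟩ := (Finsupp.mem_span_image_iff_linearCombination ℝ).1 hy
  change ‖T _‖ ≤ δ * ‖_‖
  refine le_of_sq_le_sq ?_ (by positivity)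
  rw [Finsupp.linearCombination_apply, Finsupp.sum, mul_pow, h.norm_sq_sum, h.norm_sq_map_sum,
    Finset.mul_sum]
  refine Finset.sum_le_sum fun i hi => ?_
  rw [mul_comm]
  exact mul_le_mul_of_nonneg_right (hs i (hl hi)) (sq_nonneg _)

/-- The upper bound: truncating the singular value expansion to `F` leaves only directions on which
`T` has norm at most `δ`. -/
theorem exists_linear_algorithm [CompleteSpace X] (h : IsSingularSystem T f μ) {δ : ℝ}
    (hδ : 0 ≤ δ) {F : Finset ι} (hF : ∀ i ∉ F, μ i ≤ δ ^ 2) :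
    ∃ A ∈ (algorithms .linear F.card : Set (X → Y)), worstCaseError T A ≤ ENNReal.ofReal δ := by
  classical
  refine ⟨fun x => ∑ i ∈ F, inner ℝ (f i) x • T (f i),
    ⟨fun v => innerSL ℝ (f (F.equivFin.symm v)), fun v => T (f (F.equivFin.symm v)),
      fun x => ?_⟩, ?_⟩
  · change ∑ i ∈ F, inner ℝ (f i) x • T (f i) = _
    rw [← Finset.sum_coe_sort, ← Equiv.sum_comp F.equivFin.symm]
    rfl
  set V := (Submodule.span ℝ (f '' {i | i ∉ F})).topologicalClosure with hV
  have : CompleteSpace V := (Submodule.isClosed_topologicalClosure _).completeSpace_coe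
  have hmem : ∀ i ∉ F, f i ∈ V := fun i hi =>
    Submodule.le_topologicalClosure _ (Submodule.subset_span ⟨i, hi, rfl⟩)
  have horth : ∀ i ∈ F, ∀ y ∈ V, inner ℝ (f i) y = 0 := by
    intro i hi y hy
    have hcl : IsClosed {y : X | inner ℝ (f i) y = 0} := isClosed_eq (by fun_prop) (by fun_prop)
    refine closure_minimal (s := (Submodule.span ℝ (f '' {i | i ∉ F}) : Set X)) ?_ hcl hy
    intro z hz
    induction hz using Submodule.span_induction with
    | mem z hz =>
      obtain ⟨j, hj, rfl⟩ := hz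
      exact h.orthonormal.2 fun hij => hj (hij ▸ hi)
    | zero => simp
    | add a b _ _ ha hb => simpa [inner_add_right] using by rw [ha, hb, add_zero]
    | smul r a _ ha => simpa [inner_smul_right] using Or.inr ha
  refine iSup₂_le fun x hx => ?_
  have hx1 : ‖x‖ ≤ 1 := by simpa using hx
  set p : X := V.starProjection x with hp
  have hpV : p ∈ V := V.starProjection_apply_mem x
  -- Without its components in `V` and in the span of `F`, `x` is orthogonal to every `f i`, so `T`
  -- kills the rest. Infinite expansions are thereby avoided.
  have hres : T (x - p - ∑ i ∈ F, inner ℝ (f i) x • f i) = 0 := by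
    refine h.map_eq_zero _ fun i => ?_
    rw [inner_sub_right, inner_sub_right, inner_sum]
    by_cases hi : i ∈ F
    · rw [horth i hi p hpV, Finset.sum_eq_single i]
      · rw [inner_smul_right, real_inner_self_eq_norm_sq, h.orthonormal.1]
        simp
      · intro j _ hj
        rw [inner_smul_right, h.orthonormal.2 hj.symm, mul_zero]
      · exact fun hi' => (hi' hi).elim
    · have h1 : inner ℝ (f i) (x - p) = 0 := by
        exact V.sub_starProjection_mem_orthogonal x _ (hmem i hi)
      rw [← inner_sub_right, h1, zero_sub, neg_eq_zero]
      refine Finset.sum_eq_zero fun j hj => ?_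
      rw [inner_smul_right, h.orthonormal.2 (ne_of_mem_of_not_mem hj hi).symm, mul_zero]
  have hdiff : ∑ i ∈ F, inner ℝ (f i) x • T (f i) - T x = -T p := by
    simp only [map_sub, map_sum, map_smul] at hres
    rw [sub_sub, sub_eq_zero] at hres
    rw [hres]; abel
  rw [hdiff, enorm_neg, ← ofReal_norm]
  refine ENNReal.ofReal_le_ofReal ?_
  calc ‖T p‖ ≤ δ * ‖p‖ := h.norm_map_le_of_mem_span hδ hF hpV
    _ ≤ δ * 1 := by
      gcongr
      exact (V.norm_starProjection_apply_le x).trans hx1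
    _ = δ := mul_one δ

/-- The lower bound, by a dimension count against the functionals that are used when all previous
answers are zero. -/
theorem lt_minimalError (h : IsSingularSystem T f μ) {δ : ℝ} (hδ : 0 ≤ δ) {F : Finset ι}
    (hF : ∀ i ∈ F, δ ^ 2 < μ i) {n : ℕ} (hn : n < F.card) :
    ENNReal.ofReal δ < minimalError .adaptive T n := by
  classical
  have hne : F.Nonempty := Finset.card_pos.1 (by omega)
  obtain ⟨i₀, hi₀, hmin⟩ := F.exists_min_image μ hne
  -- Every algorithm is shown to have error at least `√(μ i₀)`, a bound independent of the
  -- algorithm, so that the strict inequality survives the infimum.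
  refine ((ENNReal.ofReal_lt_ofReal_iff_of_nonneg hδ).2
    ((Real.lt_sqrt hδ).2 (hF i₀ hi₀))).trans_le (le_iInf₂ ?_)
  rintro A ⟨L, φ, hA⟩
  -- `Φ` sends coefficients on `F` to the answers along the all-zero path. As `n < F.card`, it has a
  -- nonzero kernel vector.
  let Φ : (F → ℝ) →ₗ[ℝ] (Fin n → ℝ) :=
    (LinearMap.pi fun v : Fin n => (L (List.replicate v 0)).toLinearMap) ∘ₗ
      Fintype.linearCombination ℝ fun i : F => f i
  obtain ⟨c, hc, hc0⟩ := Submodule.exists_mem_ne_zero_of_ne_bot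
    (LinearMap.ker_ne_bot_of_finrank_lt (f := Φ) (by simpa using hn))
  set c' : ι → ℝ := fun i => if hi : i ∈ F then c ⟨i, hi⟩ else 0 with hc'
  set y : X := ∑ i ∈ F, c' i • f i with hy
  have hyc : y = Fintype.linearCombination ℝ (fun i : F => f i) c := by
    rw [hy, ← Finset.sum_coe_sort, Fintype.linearCombination_apply]
    exact Finset.sum_congr rfl fun i _ => by simp [hc']
  have hL : ∀ v < n, L (List.replicate v 0) y = 0 := fun v hv => by
    rw [hyc]
    exact congrFun (LinearMap.mem_ker.1 hc) ⟨v, hv⟩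
  have hy0 : y ≠ 0 := by
    intro h0
    have h1 := h.norm_sq_sum F c'
    rw [← hy, h0, norm_zero, zero_pow two_ne_zero] at h1
    refine hc0 (funext fun i => ?_)
    have := (Finset.sum_eq_zero_iff_of_nonneg fun i _ => sq_nonneg (c' i)).1 h1.symm i i.2
    simpa [hc'] using this
  have hTy : √(μ i₀) * ‖y‖ ≤ ‖T y‖ := by
    refine le_of_sq_le_sq ?_ (norm_nonneg _)
    rw [mul_pow, Real.sq_sqrt ((sq_nonneg δ).trans (hF i₀ hi₀).le), hy, h.norm_sq_sum,
      h.norm_sq_map_sum, Finset.mul_sum]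
    refine Finset.sum_le_sum fun i hi => ?_
    rw [mul_comm]
    exact mul_le_mul_of_nonneg_left (hmin i hi) (sq_nonneg _)
  have hyn : 0 < ‖y‖ := norm_pos_iff.2 hy0
  have key := enorm_le_worstCaseError T A (f := ‖y‖⁻¹ • y)
    (by rw [norm_smul, norm_inv, norm_norm, inv_mul_cancel₀ hyn.ne'])
    (by
      rw [hA, hA, adaptiveInfo_eq_replicate, adaptiveInfo_eq_replicate]
      · intro v hv
        rw [map_neg, map_smul, hL v hv, smul_zero, neg_zero]
      · intro v hv
        rw [map_smul, hL v hv, smul_zero])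
  refine le_trans ?_ key
  rw [← ofReal_norm]
  refine ENNReal.ofReal_le_ofReal ?_
  rw [map_smul, norm_smul, norm_inv, norm_norm, inv_mul_eq_div, le_div_iff₀ hyn]
  exact hTy

/-- Each class lies between the linear and the adaptive one, so the upper bound from the former and
the lower bound for the latter settle both. -/
theorem isLeast_ncard [CompleteSpace X] (h : IsSingularSystem T f μ) (c : AlgorithmClass) {δ : ℝ}
    (hδ : 0 ≤ δ) (hfin : {i | δ ^ 2 < μ i}.Finite) :
    IsLeast (sufficientInfo c T δ) {i | δ ^ 2 < μ i}.ncard := by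
  have hcard : {i | δ ^ 2 < μ i}.ncard = hfin.toFinset.card := Set.ncard_eq_toFinset_card _ hfin
  rw [hcard]
  have hsub : ∀ n, (algorithms .linear n : Set (X → Y)) ⊆ algorithms c n ∧
      (algorithms c n : Set (X → Y)) ⊆ algorithms .adaptive n := fun n => by
    cases c
    · exact ⟨subset_rfl, algorithms_linear_subset n⟩
    · exact ⟨algorithms_linear_subset n, subset_rfl⟩
  constructor
  · obtain ⟨A, hA, hle⟩ := h.exists_linear_algorithm hδ (F := hfin.toFinset)
      (fun i hi => by simpa using hi)
    exact (biInf_le (worstCaseError T) ((hsub _).1 hA)).trans hle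
  · intro n hn
    by_contra! hlt
    have h1 := h.lt_minimalError hδ (F := hfin.toFinset) (fun i hi => by simpa using hi) hlt
    have h2 : minimalError .adaptive T n ≤ minimalError c T n :=
      biInf_mono fun A hA => (hsub n).2 hA
    exact absurd hn (not_le.2 (h1.trans_le h2))

theorem infoComplexity_eq [CompleteSpace X] (h : IsSingularSystem T f μ) (c : AlgorithmClass)
    {δ : ℝ} (hδ : 0 ≤ δ) (hfin : {i | δ ^ 2 < μ i}.Finite) :
    infoComplexity c T δ = {i | δ ^ 2 < μ i}.ncard :=
  (h.isLeast_ncard c hδ hfin).csInf_eq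

end IsSingularSystem

end InformationComplexity


/-! ### Antisymmetric tensors and their inner products -/

section TensorPower

variable {H : Type u} [NormedAddCommGroup H] [InnerProductSpace ℝ H] {d : ℕ}
variable {G : Type v} [NormedAddCommGroup G] [InnerProductSpace ℝ G]

theorem continuousLinearMap_ext_tprod {Y : Type*} [NormedAddCommGroup Y] [NormedSpace ℝ Y]
    {A B : TensorPower H d →L[ℝ] Y} (h : ∀ f, A (tprod f) = B (tprod f)) : A = B := by
  ext x
  induction x using UniformSpace.Completion.induction_on with
  | hp => exact isClosed_eq (by fun_prop) (by fun_prop)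
  | ih x =>
    obtain ⟨n, c, f, rfl⟩ := exists_eq_sum x
    have hx : ((∑ i, c i • preTprod (f i) : PreTensorPower H d) : TensorPower H d) =
        ∑ i, c i • tprod (f i) := by
      have := map_sum (UniformSpace.Completion.toComplL (𝕜 := ℝ) (E := PreTensorPower H d))
        (fun i => c i • preTprod (f i)) Finset.univ
      simp only [map_smul] at this
      exact this
    rw [hx]
    simp [h]

theorem eq_zero_of_inner_tprod {x : TensorPower H d} (h : ∀ f, inner ℝ x (tprod f) = 0) :
    x = 0 := by
  have : innerSL ℝ x = 0 := continuousLinearMap_ext_tprod fun f => by simpa using h f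
  rw [← inner_self_eq_zero (𝕜 := ℝ)]
  exact congrArg (fun A : TensorPower H d →L[ℝ] ℝ => A x) this

/-- The adjoint of a tensor power acts factorwise; only its values on simple tensors are needed. -/
theorem inner_tensorPowerMap_tprod [CompleteSpace H] [CompleteSpace G] (S : H →L[ℝ] G)
    (x : TensorPower H d) (g : Fin d → G) :
    inner ℝ (tprod g) (tensorPowerMap d S x) =
      inner ℝ (tprod fun l => ContinuousLinearMap.adjoint S (g l)) x := by
  have : (innerSL ℝ (tprod g)) ∘L tensorPowerMap d S =
      innerSL ℝ (tprod fun l => ContinuousLinearMap.adjoint S (g l)) :=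
    continuousLinearMap_ext_tprod fun f => by
      simp [tensorPowerMap_tprod, inner_tprod, ContinuousLinearMap.adjoint_inner_left]
  exact congrArg (fun A : TensorPower H d →L[ℝ] ℝ => A x) this

theorem tensorPowerMap_permute (S : H →L[ℝ] G) (π : Equiv.Perm (Fin d)) (x : TensorPower H d) :
    tensorPowerMap d S (permute π x) = permute π (tensorPowerMap d S x) := by
  have : tensorPowerMap d S ∘L permute π = permute π ∘L tensorPowerMap d S :=
    continuousLinearMap_ext_tprod fun f => by simp [tensorPowerMap_tprod, permute_tprod]
  exact congrArg (fun A : TensorPower H d →L[ℝ] TensorPower G d => A x) this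

theorem tensorPowerMap_antisymmetrizer (S : H →L[ℝ] G) (x : TensorPower H d) :
    tensorPowerMap d S (antisymmetrizer H d x) = antisymmetrizer G d (tensorPowerMap d S x) := by
  simp [antisymmetrizer, smul_apply, sum_apply, tensorPowerMap_permute]

theorem inner_permute_permute (π : Equiv.Perm (Fin d)) (x y : TensorPower H d) :
    inner ℝ (permute π x) (permute π y) = inner ℝ x y := by
  -- Density is applied one argument at a time: first both tensors simple, then `y` general, then
  -- `x`.
  have h1 : ∀ f : Fin d → H,
      (innerSL ℝ (permute π (tprod f))) ∘L permute π = innerSL ℝ (tprod f) := fun f =>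
    continuousLinearMap_ext_tprod fun g => by
      simp only [ContinuousLinearMap.comp_apply, innerSL_apply_apply, permute_tprod, inner_tprod]
      exact Equiv.prod_comp π⁻¹ fun l => inner ℝ (f l) (g l)
  have h2 : (innerSL ℝ (permute π y)) ∘L permute π = innerSL ℝ y :=
    continuousLinearMap_ext_tprod fun f => by
      have := congrArg (fun A : TensorPower H d →L[ℝ] ℝ => A y) (h1 f)
      simp only [ContinuousLinearMap.comp_apply, innerSL_apply_apply] at this ⊢
      rw [real_inner_comm, this, real_inner_comm]
  have := congrArg (fun A : TensorPower H d →L[ℝ] ℝ => A x) h2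
  simp only [ContinuousLinearMap.comp_apply, innerSL_apply_apply] at this
  rw [real_inner_comm, this, real_inner_comm]

theorem sign_mul_self (π : Equiv.Perm (Fin d)) :
    ((Equiv.Perm.sign π : ℤ) : ℝ) * ((Equiv.Perm.sign π : ℤ) : ℝ) = 1 := by
  rw [← Int.cast_mul, ← Units.val_mul, Int.units_mul_self]; simp

theorem sign_mul_inner_permute (π : Equiv.Perm (Fin d)) (x : TensorPower H d)
    {y : TensorPower H d} (hy : y ∈ antisymSubspace H d) :
    ((Equiv.Perm.sign π : ℤ) : ℝ) * inner ℝ (permute π x) y = inner ℝ x y := by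
  conv_lhs => rw [hy π]
  rw [inner_smul_right, inner_permute_permute, ← mul_assoc, sign_mul_self, one_mul]

/-- Permutations are isometries and `y` absorbs them up to sign, so all `d!` terms agree. In effect,
the antisymmetrizer is the orthogonal projection. -/
theorem inner_antisymmetrizer_left (x : TensorPower H d) {y : TensorPower H d}
    (hy : y ∈ antisymSubspace H d) : inner ℝ (antisymmetrizer H d x) y = inner ℝ x y := by
  simp only [antisymmetrizer, smul_apply, sum_apply, sum_inner, real_inner_smul_left,
    sign_mul_inner_permute _ _ hy]
  rw [Finset.sum_const, Finset.card_univ, Fintype.card_perm, Fintype.card_fin, nsmul_eq_mul,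
    ← mul_assoc, inv_mul_cancel₀ (by positivity), one_mul]

theorem antisymmetrizer_mem (x : TensorPower H d) :
    antisymmetrizer H d x ∈ antisymSubspace H d := by
  have : antisymmetrizer H d x ∈ (antisymSubspace H d : Set (TensorPower H d)) := by
    rw [← range_antisymmetrizer]; exact ⟨x, rfl⟩
  exact this

instance : CompleteSpace (antisymSubspace H d) := by
  have : IsClosed (antisymSubspace H d : Set (TensorPower H d)) := by
    have h : (antisymSubspace H d : Set (TensorPower H d)) =
        ⋂ π : Equiv.Perm (Fin d), {f | f = ((Equiv.Perm.sign π : ℤ) : ℝ) • permute π f} := by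
      ext f
      simp only [Set.mem_iInter]
      rfl
    rw [h]
    exact isClosed_iInter fun π => isClosed_eq (by fun_prop) (by fun_prop)
  exact this.completeSpace_coe

/-- Two strictly increasing tuples that agree up to a permutation are equal, and the permutation is
the identity. -/
theorem eq_and_eq_one_of_strictMono {k k' : Fin d → ℕ} (hk : StrictMono k) (hk' : StrictMono k')
    {π : Equiv.Perm (Fin d)} (h : ∀ l, k l = k' (π l)) : k = k' ∧ π = 1 := by
  have hkk : k = k' := by
    refine (StrictMono.range_inj hk hk').1 ?_
    have : k = k' ∘ π := funext h
    rw [this, Set.range_comp, π.surjective.range_eq, Set.image_univ]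
  refine ⟨hkk, Equiv.ext fun l => hk'.injective ?_⟩
  rw [← h l, hkk]
  rfl

/-- Only one antisymmetrizer has to be expanded, and since both tuples increase strictly, only the
identity permutation can contribute. This is used for the eigenvectors with `μ = 1` and for their
images with `μ = lam`. -/
theorem inner_antisymmetrizer_tprod (b : ℕ → H) (μ : ℕ → ℝ) {k k' : Fin d → ℕ}
    (hk : StrictMono k) (hk' : StrictMono k')
    (h : ∀ l m, inner ℝ (b (k l)) (b (k' m)) = if k l = k' m then μ (k l) else 0) :
    inner ℝ (antisymmetrizer H d (tprod fun l => b (k l)))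
        (antisymmetrizer H d (tprod fun l => b (k' l))) =
      if k = k' then (d.factorial : ℝ)⁻¹ * ∏ l, μ (k l) else 0 := by
  rw [inner_antisymmetrizer_left _ (antisymmetrizer_mem _)]
  simp only [antisymmetrizer, smul_apply, sum_apply, inner_sum, real_inner_smul_right,
    permute_tprod, inner_tprod, h]
  rw [Finset.sum_eq_single 1]
  · split_ifs with hkk
    · simp [hkk]
    · obtain ⟨l, hl⟩ := Function.ne_iff.1 hkk
      rw [Finset.prod_eq_zero (Finset.mem_univ l) (by simp [hl]), mul_zero, mul_zero]
  · intro π _ hπ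
    have : ∃ l, k l ≠ k' (π⁻¹ l) := by
      by_contra! hall
      exact hπ (inv_eq_one.1 (eq_and_eq_one_of_strictMono hk hk' hall).2)
    obtain ⟨l, hl⟩ := this
    rw [Finset.prod_eq_zero (Finset.mem_univ l) (if_neg hl), mul_zero]
  · simp

/-- The simple tensor as a multilinear map. -/
noncomputable def tprodMultilinear (H : Type u) [NormedAddCommGroup H] [InnerProductSpace ℝ H]
    (d : ℕ) : MultilinearMap ℝ (fun _ : Fin d => H) (TensorPower H d) :=
  (UniformSpace.Completion.toComplL (𝕜 := ℝ)
    (E := PreTensorPower H d)).toLinearMap.compMultilinearMap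
    (PiTensorProduct.tprod ℝ : MultilinearMap ℝ (fun _ : Fin d => H) (⨂[ℝ] _ : Fin d, H))

theorem tprodMultilinear_apply (f : Fin d → H) : tprodMultilinear H d f = tprod f := rfl

theorem norm_tprod (f : Fin d → H) : ‖tprod f‖ = ∏ l, ‖f l‖ := by
  refine (sq_eq_sq₀ (norm_nonneg _) (by positivity)).1 ?_
  rw [← real_inner_self_eq_norm_sq, inner_tprod, ← Finset.prod_pow]
  simp

/-- Continuity in a single slot makes the kernel a closed subspace, which lets one factor at a time
pass to a closed span. -/
theorem exists_inner_tprod_update_eq (x : TensorPower H d) (g : Fin d → H) (l : Fin d) :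
    ∃ A : H →L[ℝ] ℝ, ∀ y, A y = inner ℝ (tprod (Function.update g l y)) x := by
  refine ⟨(innerSL ℝ x) ∘L (((tprodMultilinear H d).toLinearMap g l).mkContinuous
    (∏ m ∈ Finset.univ.erase l, ‖g m‖) fun y => ?_), fun y => ?_⟩
  · rw [MultilinearMap.toLinearMap_apply, tprodMultilinear_apply, norm_tprod,
      ← Finset.prod_erase_mul _ _ (Finset.mem_univ l), Function.update_self]
    refine (congrArg (· * ‖y‖) (Finset.prod_congr rfl fun m hm => ?_)).le
    rw [Function.update_of_ne (Finset.ne_of_mem_erase hm)]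
  · simp [tprodMultilinear_apply, real_inner_comm]

/-- A tensor that is orthogonal to all simple tensors with factors in `B` is orthogonal to those
with factors in the closed span of `B`. -/
theorem inner_tprod_eq_zero_of_mem_closure {x : TensorPower H d} {B : Set H}
    (h : ∀ f : Fin d → H, (∀ l, f l ∈ B) → inner ℝ (tprod f) x = 0) (f : Fin d → H)
    (hf : ∀ l, f l ∈ (Submodule.span ℝ B).topologicalClosure) : inner ℝ (tprod f) x = 0 := by
  classical
  -- Induction on the set `s` of slots already freed: those in `s` range over the closed span, the
  -- others still over `B`.
  suffices H : ∀ s : Finset (Fin d), ∀ f : Fin d → H,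
      (∀ l ∈ s, f l ∈ (Submodule.span ℝ B).topologicalClosure) → (∀ l ∉ s, f l ∈ B) →
      inner ℝ (tprod f) x = 0 from
    H Finset.univ f (fun l _ => hf l) (fun l hl => (hl (Finset.mem_univ l)).elim)
  intro s
  induction s using Finset.induction_on with
  | empty => exact fun f _ hf => h f fun l => hf l (Finset.notMem_empty l)
  | insert a s ha ih =>
    intro f hf1 hf2
    obtain ⟨A, hA⟩ := exists_inner_tprod_update_eq x f a
    have hle : (Submodule.span ℝ B).topologicalClosure ≤ LinearMap.ker A.toLinearMap := by
      refine Submodule.topologicalClosure_minimal _ (Submodule.span_le.2 fun b hb => ?_)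
        A.isClosed_ker
      refine (hA b).trans (ih _ (fun l hl => ?_) fun l hl => ?_)
      · rw [Function.update_of_ne (ne_of_mem_of_not_mem hl ha)]
        exact hf1 l (Finset.mem_insert_of_mem hl)
      · by_cases hla : l = a
        · subst hla
          simpa using hb
        · rw [Function.update_of_ne hla]
          exact hf2 l (by simp [hla, hl])
    have := hle (hf1 a (Finset.mem_insert_self a s))
    rw [LinearMap.mem_ker] at this
    have h2 := (hA (f a)).symm.trans this
    rwa [Function.update_eq_self] at h2

theorem inner_tprod_comp_perm {x : TensorPower H d} (hx : x ∈ antisymSubspace H d)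
    (f : Fin d → H) (π : Equiv.Perm (Fin d)) :
    inner ℝ (tprod fun l => f (π l)) x =
      ((Equiv.Perm.sign π : ℤ) : ℝ) * inner ℝ (tprod f) x := by
  rw [← sign_mul_inner_permute π⁻¹ (tprod f) hx, permute_tprod, Equiv.Perm.sign_inv, ← mul_assoc,
    sign_mul_self, one_mul, inv_inv]

/-- An antisymmetric tensor is orthogonal to all simple tensors built from a sequence if it is
orthogonal to those with strictly increasing indices. -/
theorem inner_tprod_eq_zero_of_strictMono {x : TensorPower H d} (hx : x ∈ antisymSubspace H d)
    (b : ℕ → H) {p : ℕ → Prop}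
    (h : ∀ k : Fin d → ℕ, StrictMono k → (∀ l, p (k l)) → inner ℝ (tprod fun l => b (k l)) x = 0)
    (k : Fin d → ℕ) (hk : ∀ l, p (k l)) : inner ℝ (tprod fun l => b (k l)) x = 0 := by
  by_cases hinj : Function.Injective k
  · have hs : StrictMono (k ∘ Tuple.sort k) :=
      (Tuple.monotone_sort k).strictMono_of_injective (hinj.comp (Tuple.sort k).injective)
    have h0 := h _ hs fun l => hk _
    have h1 := inner_tprod_comp_perm hx (fun l => b (k l)) (Tuple.sort k)
    rw [← one_mul (inner ℝ _ _), ← sign_mul_self (Tuple.sort k), mul_assoc, ← h1]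
    exact (congrArg _ h0).trans (mul_zero _)
  · rw [Function.not_injective_iff] at hinj
    obtain ⟨i, j, hij, hne⟩ := hinj
    have h1 := inner_tprod_comp_perm hx (fun l => b (k l)) (Equiv.swap i j)
    -- Swapping two equal factors changes nothing but flips the sign, so the inner product is its
    -- own negative.
    have h2 : (fun l => b (k (Equiv.swap i j l))) = fun l => b (k l) := by
      funext l
      rw [Equiv.swap_apply_def]
      split_ifs with hi hj
      · rw [hi, hij]
      · rw [hj, hij]
      · rfl
    rw [h2, Equiv.Perm.sign_swap hne] at h1
    simp at h1
    linarith

end TensorPower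


/-! ### Counting increasing tuples with large product -/

section Counting

/-- `lam 1 ≥ lam 2 ≥ ⋯ ≥ 0` is a null sequence. -/
structure IsNonincreasingNullSequence (lam : ℕ → ℝ) : Prop where
  succ_le : ∀ i, 1 ≤ i → lam (i + 1) ≤ lam i
  nonneg : ∀ i, 1 ≤ i → 0 ≤ lam i
  exists_le : ∀ t, 0 < t → ∃ i, 1 ≤ i ∧ lam i ≤ t

theorem _root_.StrictMono.apply_zero_add_le {m : ℕ} {k : Fin (m + 1) → ℕ} (hk : StrictMono k)
    (l : Fin (m + 1)) : k 0 + l ≤ k l := by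
  induction l using Fin.induction with
  | zero => simp
  | succ l ih =>
    have := hk (Fin.castSucc_lt_succ (i := l))
    simp only [Fin.val_castSucc, Fin.val_succ] at ih ⊢
    omega

/-- The strictly increasing `m`-tuples `k` with entries at least `a` and `t < P ∏ lam (k l)`. -/
def tupleSet (lam : ℕ → ℝ) (t : ℝ) (m a : ℕ) (P : ℝ) : Set (Fin m → ℕ) :=
  {k | StrictMono k ∧ (∀ l, a ≤ k l) ∧ t < P * ∏ l, lam (k l)}

namespace IsNonincreasingNullSequence

variable {lam : ℕ → ℝ}

theorem le_of_le (h : IsNonincreasingNullSequence lam) {i j : ℕ} (hi : 1 ≤ i) (hij : i ≤ j) :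
    lam j ≤ lam i := by
  induction j, hij using Nat.le_induction with
  | base => rfl
  | succ j hij ih => exact (h.succ_le j (hi.trans hij)).trans ih

theorem prod_le_prod (h : IsNonincreasingNullSequence lam) {j a b : ℕ} (ha : 1 ≤ a) (hab : a ≤ b) :
    ∏ m ∈ Finset.range j, lam (b + m) ≤ ∏ m ∈ Finset.range j, lam (a + m) :=
  Finset.prod_le_prod (fun m _ => h.nonneg _ (by omega)) fun m _ => h.le_of_le (by omega) (by omega)

theorem isLeast_index (h : IsNonincreasingNullSequence lam) {j : ℕ} (hj : 1 ≤ j) {t : ℝ}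
    (ht : 0 < t) : IsLeast (indexSet lam j t) (index lam j t) := by
  suffices hne : (indexSet lam j t).Nonempty from
    ⟨Nat.sInf_mem hne, fun _ hn => Nat.sInf_le hn⟩
  obtain ⟨j, rfl⟩ : ∃ j', j = j' + 1 := ⟨j - 1, by omega⟩
  set M : ℝ := max 1 (lam 1)
  have hM : 0 < M := lt_max_of_lt_left one_pos
  -- Only the first factor has to be small, as each of the other `j` is at most `M`. The maximum
  -- with `1` keeps `M` positive even if `lam 1 = 0`.
  obtain ⟨i, hi, hle⟩ := h.exists_le (t / M ^ j) (by positivity)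
  refine ⟨i, hi, ?_⟩
  rw [Finset.prod_range_succ', add_zero]
  have h1 : ∏ m ∈ Finset.range j, lam (i + (m + 1)) ≤ M ^ j := by
    refine (Finset.prod_le_prod (g := fun _ => M) (fun m _ => h.nonneg _ (by omega)) fun m _ =>
      (h.le_of_le le_rfl (by omega)).trans (le_max_right _ _)).trans_eq ?_
    simp
  calc _ ≤ M ^ j * (t / M ^ j) := mul_le_mul h1 hle (h.nonneg i hi) (by positivity)
    _ = t := mul_div_cancel₀ t (by positivity)

/-- Block products do not increase with the starting point, so `indexSet` is upward closed and its
minimum decides membership. -/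
theorem lt_index_iff (h : IsNonincreasingNullSequence lam) {j : ℕ} (hj : 1 ≤ j) {t : ℝ}
    (ht : 0 < t) {a : ℕ} (ha : 1 ≤ a) :
    a < index lam j t ↔ t < ∏ m ∈ Finset.range j, lam (a + m) := by
  have hl := h.isLeast_index hj ht
  constructor
  · intro hlt
    by_contra! hle
    exact absurd (hl.2 ⟨ha, hle⟩) (not_le.2 hlt)
  · intro hlt
    by_contra! hle
    exact absurd ((h.prod_le_prod hl.1.1 hle).trans hl.1.2) (not_le.2 hlt)

theorem lam_pos_of_lt_index (h : IsNonincreasingNullSequence lam) {j : ℕ} (hj : 1 ≤ j) {t : ℝ}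
    (ht : 0 < t) {a : ℕ} (ha : 1 ≤ a) (hlt : a < index lam j t) : 0 < lam a := by
  refine lt_of_le_of_ne (h.nonneg a ha) fun h0 => ?_
  have := (h.lt_index_iff hj ht ha).1 hlt
  rw [Finset.prod_eq_zero (i := 0) (Finset.mem_range.2 hj) (by rw [add_zero, ← h0])] at this
  linarith

/-- Splits off the first entry. The upper bound on it loses no tuple, because `k 0 + l ≤ k l` bounds
the product by that of the consecutive block starting at `k 0`. -/
theorem tupleSet_succ (h : IsNonincreasingNullSequence lam) {t P : ℝ} (ht : 0 < t) (hP : 0 < P)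
    (m : ℕ) {a : ℕ} (ha : 1 ≤ a) :
    tupleSet lam t (m + 1) a P = ⋃ j ∈ Finset.Ico a (index lam (m + 1) (t / P)),
      (fun k : Fin m → ℕ => (Fin.cons j k : Fin (m + 1) → ℕ)) ''
        tupleSet lam t m (j + 1) (P * lam j) := by
  ext k
  simp only [Set.mem_iUnion, Finset.mem_Ico, exists_prop, Set.mem_image]
  constructor
  · rintro ⟨hk, hak, hlt⟩
    refine ⟨k 0, ⟨hak 0, ?_⟩, Fin.tail k, ⟨?_, fun l => ?_, ?_⟩, Fin.cons_self_tail k⟩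
    · rw [h.lt_index_iff (by omega) (by positivity) (hak 0 |>.trans' ha), div_lt_iff₀' hP]
      refine hlt.trans_le (mul_le_mul_of_nonneg_left ?_ hP.le)
      rw [Finset.prod_range]
      refine Finset.prod_le_prod (fun l _ => h.nonneg _ (ha.trans (hak l))) fun l _ =>
        h.le_of_le (by have := hak 0; omega) (hk.apply_zero_add_le l)
    · exact hk.comp (Fin.strictMono_succ)
    · exact hk (Fin.succ_pos l)
    · rw [Fin.prod_univ_succ] at hlt
      rw [mul_assoc]
      exact hlt
  · rintro ⟨j, ⟨haj, -⟩, k', ⟨hk', hjk, hlt⟩, rfl⟩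
    refine ⟨Fin.strictMono_cons.2 ⟨fun l => hjk l, hk'⟩, fun l => ?_, ?_⟩
    · refine Fin.cases ?_ (fun l => ?_) l
      · simpa using haj
      · have := hjk l
        simp only [Fin.cons_succ]
        omega
    · simpa [Fin.prod_univ_succ, mul_assoc] using hlt

theorem finite_tupleSet (h : IsNonincreasingNullSequence lam) {t : ℝ} (ht : 0 < t) (m : ℕ) {a : ℕ}
    (ha : 1 ≤ a) {P : ℝ} (hP : 0 < P) : (tupleSet lam t m a P).Finite := by
  induction m generalizing a P with
  | zero => exact Set.toFinite _
  | succ m ih =>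
    rw [h.tupleSet_succ ht hP m ha]
    refine Set.Finite.biUnion (Finset.finite_toSet _) fun j hj => (ih (by omega) ?_).image _
    rw [Finset.mem_coe, Finset.mem_Ico] at hj
    exact mul_pos hP (h.lam_pos_of_lt_index (by omega) (by positivity) (ha.trans hj.1) hj.2)

theorem ncard_tupleSet_succ (h : IsNonincreasingNullSequence lam) {t P : ℝ} (ht : 0 < t)
    (hP : 0 < P) (m : ℕ) {a : ℕ} (ha : 1 ≤ a) :
    (tupleSet lam t (m + 1) a P).ncard = ∑ j ∈ Finset.Ico a (index lam (m + 1) (t / P)),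
      (tupleSet lam t m (j + 1) (P * lam j)).ncard := by
  have hfin : ∀ j ∈ (Finset.Ico a (index lam (m + 1) (t / P)) : Set ℕ),
      ((fun k : Fin m → ℕ => (Fin.cons j k : Fin (m + 1) → ℕ)) ''
        tupleSet lam t m (j + 1) (P * lam j)).Finite := fun j hj => by
    rw [Finset.mem_coe, Finset.mem_Ico] at hj
    exact (h.finite_tupleSet ht m (by omega) (mul_pos hP
      (h.lam_pos_of_lt_index (by omega) (by positivity) (ha.trans hj.1) hj.2))).image _
  have hdisj : (Finset.Ico a (index lam (m + 1) (t / P)) : Set ℕ).PairwiseDisjoint fun j =>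
      (fun k : Fin m → ℕ => (Fin.cons j k : Fin (m + 1) → ℕ)) ''
        tupleSet lam t m (j + 1) (P * lam j) := by
    intro i _ j _ hij
    refine Set.disjoint_left.2 ?_
    rintro _ ⟨k, _, rfl⟩ ⟨k', _, hk'⟩
    exact hij (Fin.cons_inj.1 hk').1.symm
  have := Set.Finite.ncard_biUnion (Finset.finite_toSet _) hfin hdisj
  rw [finsum_mem_coe_finset] at this
  rw [h.tupleSet_succ ht hP m ha]
  refine this.trans (Finset.sum_congr rfl fun j _ => ?_)
  exact Set.ncard_image_of_injective _ (Fin.cons_right_injective (α := fun _ => ℕ) j)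

end IsNonincreasingNullSequence

theorem ncard_tupleSet_one (lam : ℕ → ℝ) (t : ℝ) (a : ℕ) (P : ℝ) :
    (tupleSet lam t 1 a P).ncard = {j | a ≤ j ∧ t < P * lam j}.ncard := by
  have : tupleSet lam t 1 a P = (fun (j : ℕ) (_ : Fin 1) => j) '' {j | a ≤ j ∧ t < P * lam j} := by
    ext k
    constructor
    · rintro ⟨-, h1, h2⟩
      exact ⟨k 0, ⟨h1 0, by simpa using h2⟩, funext fun l => by rw [Subsingleton.elim l 0]⟩
    · rintro ⟨j, ⟨h1, h2⟩, rfl⟩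
      exact ⟨Subsingleton.strictMono _, fun _ => h1, by simpa using h2⟩
  rw [this]
  exact Set.ncard_image_of_injective _ fun i j hij => congrFun hij 0

namespace IsNonincreasingNullSequence

variable {lam : ℕ → ℝ}

/-- The condition `hk` concerns the innermost bracket: subtracting `a - 1` from `nEnt` is correct
only if all indices below `a` are among those counted by `nEnt`, which holds once `a` itself is. -/
theorem nestedSum_eq_ncard (h : IsNonincreasingNullSequence lam) {nEnt : ℝ → ℕ} {ε : ℝ}
    (hε : 0 < ε) (hent : ∀ δ, 0 < δ → nEnt δ = {j | 1 ≤ j ∧ δ ^ 2 < lam j}.ncard) (k : ℕ) {P : ℝ}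
    (hP : 0 < P) {a : ℕ} (ha : 1 ≤ a) (hk : k = 0 → ε ^ 2 < P * lam a) :
    nestedSum lam nEnt ε k P a = (tupleSet lam (ε ^ 2) (k + 1) a P).ncard := by
  induction k generalizing P a with
  | zero =>
    have hset : {j | 1 ≤ j ∧ (ε / √P) ^ 2 < lam j} =
        (Finset.Ico 1 a : Set ℕ) ∪ {j | a ≤ j ∧ ε ^ 2 < P * lam j} := by
      ext j
      simp only [Set.mem_ofPred_eq, Set.mem_union, Finset.mem_coe, Finset.mem_Ico, div_pow,
        Real.sq_sqrt hP.le, div_lt_iff₀' hP]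
      constructor
      · rintro ⟨h1, h2⟩
        rcases lt_or_ge j a with hja | hja
        · exact Or.inl ⟨h1, hja⟩
        · exact Or.inr ⟨hja, h2⟩
      · rintro (⟨h1, h2⟩ | ⟨h1, h2⟩)
        · exact ⟨h1, (hk rfl).trans_le (mul_le_mul_of_nonneg_left (h.le_of_le h1 h2.le) hP.le)⟩
        · exact ⟨ha.trans h1, h2⟩
    have hfin : {j | a ≤ j ∧ ε ^ 2 < P * lam j}.Finite := by
      refine ((h.finite_tupleSet (t := ε ^ 2) (by positivity) 1 ha hP).image fun k => k 0).subset ?_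
      rintro j ⟨h1, h2⟩
      exact ⟨fun _ => j, ⟨Subsingleton.strictMono _, fun _ => h1, by simpa using h2⟩, rfl⟩
    rw [ncard_tupleSet_one, nestedSum, hent _ (by positivity), hset,
      Set.ncard_union_eq _ (Finset.finite_toSet _) hfin, Set.ncard_coe_finset, Nat.card_Ico]
    · push_cast [ha]
      ring
    · refine Set.disjoint_left.2 fun j hj hj' => ?_
      rw [Finset.mem_coe, Finset.mem_Ico] at hj
      exact absurd hj'.1 (not_le.2 hj.2)
  | succ k ih =>
    rw [nestedSum, h.ncard_tupleSet_succ (by positivity) hP _ ha, Nat.cast_sum]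
    -- The summation index is the tuple entry plus one, so the closed upper bound becomes the strict
    -- condition `j < index …`.
    have hIcc : Finset.Icc (a + 1) (index lam (k + 2) (ε ^ 2 / P)) =
        (Finset.Ico a (index lam (k + 2) (ε ^ 2 / P))).map (addRightEmbedding 1) := by
      rw [Finset.map_add_right_Ico]
      ext l
      simp only [Finset.mem_Icc, Finset.mem_Ico]
      omega
    rw [hIcc, Finset.sum_map]
    refine Finset.sum_congr rfl fun j hj => ?_
    rw [Finset.mem_Ico] at hj
    have hj1 : 1 ≤ j := ha.trans hj.1
    have ht : 0 < ε ^ 2 / P := by positivity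
    have hpos := h.lam_pos_of_lt_index (by omega) ht hj1 hj.2
    simp only [addRightEmbedding_apply, Nat.add_sub_cancel]
    refine ih (mul_pos hP hpos) (by omega) ?_
    rintro rfl
    -- At the last sum the bound is a block of length two, `ε ^ 2 / P < lam j * lam (j + 1)`, which
    -- is exactly `hk` for the next level.
    have hlt := (h.lt_index_iff (by omega) ht hj1).1 hj.2
    rw [div_lt_iff₀' hP, Finset.prod_range_succ, Finset.prod_range_one, ← mul_assoc] at hlt
    exact hlt

end IsNonincreasingNullSequence

end Counting

/-! ### Singular systems of the two problems -/

section Problem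

variable {H : Type u} [NormedAddCommGroup H] [InnerProductSpace ℝ H] [CompleteSpace H]
variable {G : Type v} [NormedAddCommGroup G] [InnerProductSpace ℝ G] [CompleteSpace G]
variable {S : H →L[ℝ] G} {e : ℕ → H} {lam : ℕ → ℝ}

namespace IsEigenpairSequence

theorem inner_eigenvectors (h : IsEigenpairSequence (ContinuousLinearMap.adjoint S ∘L S) e lam)
    {i j : ℕ} (hi : 1 ≤ i) (hj : 1 ≤ j) : inner ℝ (e i) (e j) = if i = j then 1 else 0 := by
  have := orthonormal_iff_ite.1 h.orthonormal (i - 1) (j - 1)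
  rw [Nat.sub_add_cancel hi, Nat.sub_add_cancel hj] at this
  rw [this]
  congr 1
  exact propext (by omega)

theorem inner_map_eigenvectors
    (h : IsEigenpairSequence (ContinuousLinearMap.adjoint S ∘L S) e lam)
    {i j : ℕ} (hi : 1 ≤ i) (hj : 1 ≤ j) :
    inner ℝ (S (e i)) (S (e j)) = if i = j then lam i else 0 := by
  rw [← ContinuousLinearMap.adjoint_inner_right]
  change inner ℝ (e i) ((ContinuousLinearMap.adjoint S ∘L S) (e j)) = _
  rw [h.apply_eq j hj, inner_smul_right, h.inner_eigenvectors hi hj]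
  split_ifs with hij <;> simp [hij]

theorem map_eq_zero (h : IsEigenpairSequence (ContinuousLinearMap.adjoint S ∘L S) e lam)
    {f : H} (hf : ∀ i, 1 ≤ i → inner ℝ (e i) f = 0) : S f = 0 := by
  rw [← inner_self_eq_zero (𝕜 := ℝ), ← ContinuousLinearMap.adjoint_inner_right]
  change inner ℝ f ((ContinuousLinearMap.adjoint S ∘L S) f) = _
  rw [h.apply_eq_zero f hf, inner_zero_right]

theorem isNonincreasingNullSequence (hS : IsCompactOperator S)
    (h : IsEigenpairSequence (ContinuousLinearMap.adjoint S ∘L S) e lam) :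
    IsNonincreasingNullSequence lam where
  succ_le := h.succ_le
  nonneg i hi := by
    have := h.inner_map_eigenvectors hi hi
    rw [if_pos rfl] at this
    exact this ▸ real_inner_self_nonneg
  exists_le t ht := by
    -- If all `lam i` exceed `t`, the images of the eigenvectors are pairwise at distance more than
    -- `√t`, so no subsequence of them converges.
    by_contra! hlt
    obtain ⟨K, hK, hSK⟩ := hS.image_closedBall_subset_compact 1
    obtain ⟨x, -, φ, hφ, hlim⟩ := hK.tendsto_subseq (x := fun i => S (e (i + 1))) fun i =>
      hSK ⟨e (i + 1), by simpa using (h.orthonormal.1 i).le, rfl⟩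
    obtain ⟨N, hN⟩ := Metric.cauchySeq_iff.1 hlim.cauchySeq √t (by positivity)
    have hd := hN N le_rfl (N + 1) (by omega)
    have hne : φ N + 1 ≠ φ (N + 1) + 1 := by have := hφ N.lt_add_one; omega
    rw [dist_eq_norm, Real.lt_sqrt (norm_nonneg _)] at hd
    simp only [Function.comp_apply] at hd
    rw [@norm_sub_sq_real, h.inner_map_eigenvectors (by omega) (by omega), if_neg hne,
      ← real_inner_self_eq_norm_sq, ← real_inner_self_eq_norm_sq,
      h.inner_map_eigenvectors (by omega) (by omega),
      h.inner_map_eigenvectors (by omega) (by omega), if_pos rfl, if_pos rfl] at hd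
    have h1 := hlt (φ N + 1) (by omega)
    have h2 := hlt (φ (N + 1) + 1) (by omega)
    linarith

theorem isSingularSystem (h : IsEigenpairSequence (ContinuousLinearMap.adjoint S ∘L S) e lam) :
    IsSingularSystem S (fun i : {i : ℕ // 1 ≤ i} => e i) fun i => lam i where
  orthonormal := orthonormal_iff_ite.2 fun i j => by
    rw [h.inner_eigenvectors i.2 j.2]
    simp only [Subtype.ext_iff]
  inner_map_self i := by rw [h.inner_map_eigenvectors i.2 i.2, if_pos rfl]
  inner_map_ne i j hij := by
    rw [h.inner_map_eigenvectors i.2 j.2, if_neg (Subtype.coe_ne_coe.2 hij)]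
  map_eq_zero f hf := h.map_eq_zero fun i hi => hf ⟨i, hi⟩

/-- Whatever is orthogonal to all eigenvectors lies in the kernel of `S`, hence is orthogonal to the
range of the adjoint; then take the double orthogonal complement. -/
theorem adjoint_mem_closure_span
    (h : IsEigenpairSequence (ContinuousLinearMap.adjoint S ∘L S) e lam) (g : G) :
    ContinuousLinearMap.adjoint S g ∈ (Submodule.span ℝ (e '' Set.Ici 1)).topologicalClosure := by
  rw [← Submodule.orthogonal_orthogonal_eq_closure, Submodule.mem_orthogonal]
  intro f hf
  rw [ContinuousLinearMap.adjoint_inner_right, h.map_eq_zero, inner_zero_left]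
  intro i hi
  exact (Submodule.mem_orthogonal _ _).1 hf _ (Submodule.subset_span ⟨i, hi, rfl⟩)

/-- Tested against a simple tensor, the image of `x` pairs `x` with factors from the range of the
adjoint. These lie in the closed span of the eigenvectors, so `e` need not be a basis of `H`. -/
theorem tensorPowerMap_eq_zero
    (h : IsEigenpairSequence (ContinuousLinearMap.adjoint S ∘L S) e lam) {d : ℕ}
    {x : TensorPower H d} (hx : x ∈ antisymSubspace H d)
    (hk : ∀ k : Fin d → ℕ, StrictMono k → (∀ l, 1 ≤ k l) →
      inner ℝ (tprod fun l => e (k l)) x = 0) : tensorPowerMap d S x = 0 := by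
  refine eq_zero_of_inner_tprod fun g => ?_
  rw [real_inner_comm, inner_tensorPowerMap_tprod]
  refine inner_tprod_eq_zero_of_mem_closure (fun f hf => ?_) _ fun l =>
    h.adjoint_mem_closure_span (g l)
  choose k hk1 hke using hf
  rw [← funext hke]
  exact inner_tprod_eq_zero_of_strictMono hx e hk k hk1

/-- The factor `√(d !)` compensates the `1 / d !` in the inner products of antisymmetrised simple
tensors. The tensor power operator commutes with antisymmetrisation, so the images are computed by
the same formula. -/
theorem isSingularSystem_antisymProblem
    (h : IsEigenpairSequence (ContinuousLinearMap.adjoint S ∘L S) e lam) (d : ℕ) :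
    IsSingularSystem (antisymProblem S d)
      (fun k : {k : Fin d → ℕ // StrictMono k ∧ ∀ l, 1 ≤ k l} =>
        (⟨√(d.factorial : ℝ) • antisymmetrizer H d (tprod fun l => e (k.1 l)),
          Submodule.smul_mem _ _ (antisymmetrizer_mem _)⟩ : antisymSubspace H d))
      fun k => ∏ l, lam (k.1 l) := by
  have hsq : √(d.factorial : ℝ) * √(d.factorial : ℝ) = d.factorial :=
    Real.mul_self_sqrt (by positivity)
  have hfac : (d.factorial : ℝ) ≠ 0 := by positivity
  have hmap : ∀ k k' : {k : Fin d → ℕ // StrictMono k ∧ ∀ l, 1 ≤ k l},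
      inner ℝ (tensorPowerMap d S (√(d.factorial : ℝ) •
          antisymmetrizer H d (tprod fun l => e (k.1 l))))
        (tensorPowerMap d S (√(d.factorial : ℝ) •
          antisymmetrizer H d (tprod fun l => e (k'.1 l)))) =
        if k.1 = k'.1 then ∏ l, lam (k.1 l) else 0 := fun k k' => by
    rw [map_smul, map_smul, real_inner_smul_left, real_inner_smul_right, ← mul_assoc, hsq,
      tensorPowerMap_antisymmetrizer, tensorPowerMap_antisymmetrizer, tensorPowerMap_tprod,
      tensorPowerMap_tprod,
      inner_antisymmetrizer_tprod (fun i => S (e i)) lam k.2.1 k'.2.1 fun l m =>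
        h.inner_map_eigenvectors (k.2.2 l) (k'.2.2 m), mul_ite, mul_zero,
      mul_inv_cancel_left₀ hfac]
  refine ⟨orthonormal_iff_ite.2 fun k k' => ?_, fun k => ?_, fun k k' hkk => ?_, fun x hx => ?_⟩
  · rw [Submodule.coe_inner, real_inner_smul_left, real_inner_smul_right, ← mul_assoc, hsq,
      inner_antisymmetrizer_tprod e (fun _ => 1) k.2.1 k'.2.1 fun l m =>
        h.inner_eigenvectors (k.2.2 l) (k'.2.2 m), mul_ite, mul_zero,
      mul_inv_cancel_left₀ hfac]
    simp only [Subtype.ext_iff, Finset.prod_const_one]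
  · exact (hmap k k).trans (if_pos rfl)
  · exact (hmap k k').trans (if_neg fun h' => hkk (Subtype.ext h'))
  · refine h.tensorPowerMap_eq_zero x.2 fun k hk hk1 => ?_
    have := hx ⟨k, hk, hk1⟩
    rw [Submodule.coe_inner, real_inner_smul_left, inner_antisymmetrizer_left _ x.2] at this
    exact (mul_eq_zero.1 this).resolve_left (by positivity)

theorem isLeast_infoComplexity (hS : IsCompactOperator S)
    (h : IsEigenpairSequence (ContinuousLinearMap.adjoint S ∘L S) e lam) (c : AlgorithmClass)
    {δ : ℝ} (hδ : 0 < δ) :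
    IsLeast (sufficientInfo c S δ) (infoComplexity c S δ) ∧
      infoComplexity c S δ = {j | 1 ≤ j ∧ δ ^ 2 < lam j}.ncard := by
  have himg : Subtype.val '' {i : {i : ℕ // 1 ≤ i} | δ ^ 2 < lam i} =
      {j | 1 ≤ j ∧ δ ^ 2 < lam j} := by
    ext j; simp [and_comm]
  have hfin : {j | 1 ≤ j ∧ δ ^ 2 < lam j}.Finite := by
    refine (((h.isNonincreasingNullSequence hS).finite_tupleSet (t := δ ^ 2) (by positivity) 1
      le_rfl one_pos).image fun k => k 0).subset ?_
    rintro j ⟨h1, h2⟩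
    exact ⟨fun _ => j, ⟨Subsingleton.strictMono _, fun _ => h1, by simpa using h2⟩, rfl⟩
  have hfin' : {i : {i : ℕ // 1 ≤ i} | δ ^ 2 < lam i}.Finite :=
    Set.Finite.of_finite_image (himg ▸ hfin) Subtype.val_injective.injOn
  have heq := h.isSingularSystem.infoComplexity_eq c hδ.le hfin'
  refine ⟨heq ▸ h.isSingularSystem.isLeast_ncard c hδ.le hfin', heq.trans ?_⟩
  rw [← himg, Set.ncard_image_of_injective _ Subtype.val_injective]

theorem isLeast_infoComplexity_antisymProblem (hS : IsCompactOperator S)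
    (h : IsEigenpairSequence (ContinuousLinearMap.adjoint S ∘L S) e lam) (c : AlgorithmClass)
    (d : ℕ) {δ : ℝ} (hδ : 0 < δ) :
    IsLeast (sufficientInfo c (antisymProblem S d) δ) (infoComplexity c (antisymProblem S d) δ) ∧
      infoComplexity c (antisymProblem S d) δ = (tupleSet lam (δ ^ 2) d 1 1).ncard := by
  have himg : Subtype.val '' {k : {k : Fin d → ℕ // StrictMono k ∧ ∀ l, 1 ≤ k l} |
      δ ^ 2 < ∏ l, lam (k.1 l)} = tupleSet lam (δ ^ 2) d 1 1 := by
    ext k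
    simp only [tupleSet, one_mul, Set.mem_image, Subtype.exists, Set.mem_ofPred_eq]
    exact ⟨fun ⟨_, hk, hlt, hkk⟩ => hkk ▸ ⟨hk.1, hk.2, hlt⟩, fun ⟨h1, h2, h3⟩ =>
      ⟨k, ⟨h1, h2⟩, h3, rfl⟩⟩
  have hfin := (h.isNonincreasingNullSequence hS).finite_tupleSet (t := δ ^ 2) (by positivity) d
    le_rfl one_pos
  have hfin' : {k : {k : Fin d → ℕ // StrictMono k ∧ ∀ l, 1 ≤ k l} |
      δ ^ 2 < ∏ l, lam (k.1 l)}.Finite :=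
    Set.Finite.of_finite_image (himg ▸ hfin) Subtype.val_injective.injOn
  have hsys := h.isSingularSystem_antisymProblem d
  have heq := hsys.infoComplexity_eq c hδ.le hfin'
  refine ⟨heq ▸ hsys.isLeast_ncard c hδ.le hfin', heq.trans ?_⟩
  rw [← himg, Set.ncard_image_of_injective _ Subtype.val_injective]

end IsEigenpairSequence

end Problem

end AntisymComplexity

open AntisymComplexity in
theorem mainTheorem7 {H : Type*} [NormedAddCommGroup H] [InnerProductSpace ℝ H] [CompleteSpace H]
    {G : Type*} [NormedAddCommGroup G] [InnerProductSpace ℝ G] [CompleteSpace G]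
    (S : H →L[ℝ] G) (hS : IsCompactOperator S) (e : ℕ → H) (lam : ℕ → ℝ)
    (hlam : IsEigenpairSequence (ContinuousLinearMap.adjoint S ∘L S) e lam)
    (c : AlgorithmClass) (d : ℕ) (hd : 1 ≤ d) (ε : ℝ) (hε : 0 < ε) :
    IsLeast (sufficientInfo c (antisymProblem S d) ε) (infoComplexity c (antisymProblem S d) ε) ∧
    (∀ δ : ℝ, 0 < δ → IsLeast (sufficientInfo c S δ) (infoComplexity c S δ)) ∧
    (∀ j : ℕ, 1 ≤ j → ∀ t : ℝ, 0 < t → IsLeast (indexSet lam j t) (index lam j t)) ∧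
    (d = 1 → infoComplexity c (antisymProblem S d) ε = infoComplexity c S ε) ∧
    (2 ≤ d → (infoComplexity c (antisymProblem S d) ε : ℤ) =
      nestedSum lam (fun δ => infoComplexity c S δ) ε (d - 1) 1 1) := by
  have hseq := hlam.isNonincreasingNullSequence hS
  obtain ⟨hleast, hasy⟩ := hlam.isLeast_infoComplexity_antisymProblem hS c d hε
  refine ⟨hleast, fun δ hδ => (hlam.isLeast_infoComplexity hS c hδ).1,
    fun j hj t ht => hseq.isLeast_index hj ht, ?_, fun hd2 => ?_⟩
  · rintro rfl
    rw [hasy, ncard_tupleSet_one, (hlam.isLeast_infoComplexity hS c hε).2]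
    simp only [one_mul]
  -- For `2 ≤ d` at least one sum is present, so the condition on the innermost bracket is vacuous
  -- at the outermost level.
  · rw [hseq.nestedSum_eq_ncard hε (fun δ hδ => (hlam.isLeast_infoComplexity hS c hδ).2) (d - 1)
      one_pos le_rfl (by omega), Nat.sub_add_cancel hd, hasy]
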